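/- Let $H$ be a separable infinite-dimensional complex Hilbert space. For a positive compact operator $a$ on $H$ let $\lambda_1(a)\ge\lambda_2(a)\ge\cdots$ be its nonzero eigenvalues in decreasing order, repeated according to multiplicity, continued by zeros if $a$ has finite rank. Let $\alpha:\{0,1,2,\dots\}\to[0,\infty)$ be a monotone increasing function with $\alpha(0)=0$ and $\alpha(1)>0$. For a positive compact operator $a$ put $$\psi_\alpha(a)=\sup_{i\ge 1}\,\min\{\lambda_i(a),\alpha(i)\},$$ and for an arbitrary compact operator $a$ on $H$ put $\|a\|_\alpha=\psi_\alpha(|a|)$, where $|a|=(a^*a)^{1/2}$. Assume that $\alpha$ is concave in the sense that $$\frac{\alpha(i+1)+\alpha(i-1)}{2}\le\alpha(i)\qquad(i=1,2,3,\dots).$$ Then for all compact operators $b,c$ on $H$, $$\|b+c\|_\alpha\le\|b\|_\alpha+\|c\|_\alpha .$$ -/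

import Mathlib

noncomputable section

variable {H : Type*} [NormedAddCommGroup H] [InnerProductSpace ℂ H]

/-- The (algebraic) sum of the eigenspaces of `a` for the real eigenvalues `μ ≥ t`. As eigenspaces
for distinct eigenvalues are independent, its dimension is the number of eigenvalues `μ ≥ t`
of `a`, counted with multiplicity. -/
def eigenspacesGE (a : H →L[ℂ] H) (t : ℝ) : Submodule ℂ H :=
  ⨆ μ ∈ Set.Ici t, Module.End.eigenspace (a : H →ₗ[ℂ] H) (μ : ℂ)

/-- The eigenvalue sequence of a positive compact operator `a`: its nonzero eigenvalues in
decreasing order, counted with multiplicity, continued by zeros if there are only finitely many.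
Indices start at `0`, so `eigenvalueSeq a n` is `λ_{n+1}(a)`. It is the largest `t > 0` such that
at least `n + 1` eigenvalues of `a`, counted with multiplicity, are `≥ t`, and it is `0` if there
is no such `t` (in which case the supremum below is that of the empty set of reals). -/
def eigenvalueSeq (a : H →L[ℂ] H) (n : ℕ) : ℝ :=
  sSup {t : ℝ | 0 < t ∧ ((n + 1 : ℕ) : Cardinal) ≤ Module.rank ℂ (eigenspacesGE a t)}

/-- The non-linear trace of Sugeno type `ψ_α(a) = sup_{i ≥ 1} min (λ_i(a), α(i))` of a positive
compact operator `a`. The supremum is over `i = n + 1` with `n = 0, 1, 2, …`. -/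
def sugenoTrace (α : ℕ → ℝ) (a : H →L[ℂ] H) : ℝ :=
  ⨆ n : ℕ, min (eigenvalueSeq a n) (α (n + 1))

/-- `‖a‖_α = ψ_α(|a|)` for a compact operator `a`, where `|a| = (a* a)^{1/2}`. -/
def sugenoNorm [CompleteSpace H] (α : ℕ → ℝ) (a : H →L[ℂ] H) : ℝ :=
  sugenoTrace α (CFC.abs a)

/-- The sets whose suprema define the eigenvalue sequence are bounded. -/
theorem eigenvalueSeq_le_of_mem (a : H →L[ℂ] H) (n : ℕ) (t : ℝ)
    (ht : t ∈ {t : ℝ | 0 < t ∧ ((n + 1 : ℕ) : Cardinal) ≤ Module.rank ℂ (eigenspacesGE a t)}) :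
    t ≤ ‖a‖ := by
  by_contra! hlt
  have hbot : eigenspacesGE a t = ⊥ := by
    simp only [eigenspacesGE, iSup_eq_bot]
    intro μ hμ
    rw [Submodule.eq_bot_iff]
    intro x hx
    rw [Module.End.mem_eigenspace_iff] at hx
    have h1 : ‖a x‖ = |μ| * ‖x‖ := by
      have h0 : a x = (μ : ℂ) • x := hx
      rw [h0, norm_smul, Complex.norm_real, Real.norm_eq_abs]
    have h2 := a.le_opNorm x
    have h3 : t ≤ |μ| := le_trans hμ (le_abs_self μ)
    by_contra hne
    have h4 : 0 < ‖x‖ := norm_pos_iff.mpr hne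
    nlinarith
  have h := ht.2
  rw [hbot, rank_bot] at h
  norm_cast at h

theorem eigenvalueSeq_le (a : H →L[ℂ] H) (n : ℕ) : eigenvalueSeq a n ≤ ‖a‖ :=
  Real.sSup_le (eigenvalueSeq_le_of_mem a n) (norm_nonneg a)

/-- The supremum that defines `ψ_α(a)` is finite. -/
theorem bddAbove_sugenoTrace (α : ℕ → ℝ) (a : H →L[ℂ] H) :
    BddAbove (Set.range fun n : ℕ => min (eigenvalueSeq a n) (α (n + 1))) :=
  ⟨‖a‖, by rintro _ ⟨n, rfl⟩; exact (min_le_left _ _).trans (eigenvalueSeq_le a n)⟩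

end

/-!
The proof is a Sugeno version of Weyl's inequality for singular values. Let `N a t` be the number
of eigenvalues `≥ t` of `|a|`. On the span of the corresponding eigenvectors `t ‖x‖ ≤ ‖a x‖`,
while `‖a x‖ < t ‖x‖` for nonzero `x` orthogonal to it, since the norm of a positive compact
operator is an eigenvalue. Hence the span for `b + c` at level `s + t` contains no nonzero vector
orthogonal to both the span for `b` at level `s` and the span for `c` at level `t`, and therefore
`N (b + c) (s + t) ≤ N b s + N c t`. On the other hand `‖a‖_α ≤ σ` says that `α n ≤ σ` whenever
`n ≤ N a t` for some `t > σ`, and concavity together with `α 0 = 0` makes `α` subadditive.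
-/

open Module Module.End

theorem antitone_sub_of_midpoint_le {u : ℕ → ℝ}
    (hu : ∀ i, 1 ≤ i → (u (i + 1) + u (i - 1)) / 2 ≤ u i) : Antitone fun n => u (n + 1) - u n :=
  antitone_nat_of_succ_le fun n => by
    have := hu (n + 1) n.succ_pos
    rw [Nat.add_sub_cancel] at this
    linarith

theorem subadditive_of_antitone_sub {u : ℕ → ℝ} (hu_zero : 0 ≤ u 0)
    (hu : Antitone fun n => u (n + 1) - u n) : Subadditive u := by
  intro m n
  induction n with
  | zero => simpa using hu_zero
  | succ n ih =>
    have : u (m + n + 1) - u (m + n) ≤ u (n + 1) - u n := hu (n.le_add_left m)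
    rw [← add_assoc]
    linarith

theorem exists_add_eq_of_natCast_le_add {n : ℕ} {x y : ℕ∞} (h : n ≤ x + y) :
    ∃ p q : ℕ, p + q = n ∧ p ≤ x ∧ q ≤ y := by
  rcases le_total (n : ℕ∞) x with hx | hx
  · exact ⟨n, 0, n.add_zero, hx, zero_le⟩
  · lift x to ℕ using ne_top_of_le_ne_top (ENat.natCast_ne_top n) hx
    obtain ⟨q, rfl⟩ := exists_add_of_le (Nat.cast_le.1 hx)
    rw [Nat.cast_add, ENat.add_le_add_iff_left (ENat.natCast_ne_top x)] at h
    exact ⟨x, q, rfl, le_rfl, h⟩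

section InnerProductSpace

variable {𝕜 E : Type*} [RCLike 𝕜] [NormedAddCommGroup E] [InnerProductSpace 𝕜 E]

theorem toENat_rank_le_of_disjoint_orthogonal {W V : Submodule 𝕜 E} (h : Disjoint W Vᗮ) :
    (Module.rank 𝕜 W).toENat ≤ (Module.rank 𝕜 V).toENat := by
  by_cases hV : FiniteDimensional 𝕜 V
  · have hinj : Function.Injective (V.orthogonalProjectionOnto.toLinearMap.domRestrict W) := by
      rw [LinearMap.injective_domRestrict_iff, V.ker_orthogonalProjectionOnto]
      exact h
    exact Cardinal.toENat.monotone' (LinearMap.rank_le_of_injective _ hinj)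
  · have hV_top : (Module.rank 𝕜 V).toENat = ⊤ := by
      rwa [Cardinal.toENat_eq_top, ← not_lt, Module.rank_lt_aleph0_iff]
    exact hV_top ▸ le_top

theorem le_norm_apply_of_mem_iSup_eigenspace {T : E →ₗ[𝕜] E} (hT : T.IsSymmetric) {t : ℝ}
    (ht : 0 ≤ t) {x : E} (hx : x ∈ ⨆ μ : {μ : 𝕜 // t ≤ ‖μ‖}, eigenspace T μ) :
    t * ‖x‖ ≤ ‖T x‖ := by
  obtain ⟨v, hv, rfl⟩ := (Submodule.mem_iSup_iff_exists_finsupp _ _).1 hx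
  have hortho := hT.orthogonalFamily_eigenspaces.comp
    (Subtype.val_injective (p := fun μ : 𝕜 => t ≤ ‖μ‖))
  have hT_sum : T (v.sum fun _ y => y) = ∑ μ ∈ v.support, (μ : 𝕜) • v μ := by
    rw [Finsupp.sum, map_sum]
    exact Finset.sum_congr rfl fun μ _ => mem_eigenspace_iff.1 (hv μ)
  have hnorm : ‖v.sum fun _ y => y‖ ^ 2 = ∑ μ ∈ v.support, ‖v μ‖ ^ 2 :=
    hortho.norm_sum (fun μ => ⟨v μ, hv μ⟩) v.support
  have hnorm_apply : ‖T (v.sum fun _ y => y)‖ ^ 2 = ∑ μ ∈ v.support, (‖(μ : 𝕜)‖ * ‖v μ‖) ^ 2 := by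
    rw [hT_sum]
    simpa [norm_smul] using hortho.norm_sum (fun μ => (μ : 𝕜) • ⟨v μ, hv μ⟩) v.support
  refine le_of_sq_le_sq ?_ (norm_nonneg _)
  rw [mul_pow, hnorm, hnorm_apply, Finset.mul_sum]
  simp_rw [← mul_pow]
  gcongr with μ
  exact μ.2

end InnerProductSpace

theorem isCompactOperator_of_norm_apply_le {𝕜 E F G : Type*} [NontriviallyNormedField 𝕜]
    [SeminormedAddCommGroup E] [NormedSpace 𝕜 E] [NormedAddCommGroup F] [NormedSpace 𝕜 F]
    [CompleteSpace F] [NormedAddCommGroup G] [NormedSpace 𝕜 G] {S : E →ₗ[𝕜] G} {T : E →ₗ[𝕜] F}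
    (hS : IsCompactOperator S) (hTS : ∀ x, ‖T x‖ ≤ ‖S x‖) : IsCompactOperator T := by
  rw [isCompactOperator_iff_isCompact_closure_image_ball T one_pos]
  refine TotallyBounded.isCompact_of_isClosed (.closure ?_) isClosed_closure
  have hS_tot : TotallyBounded (S '' Metric.ball 0 1) :=
    (hS.isCompact_closure_image_ball 1).totallyBounded.subset subset_closure
  refine Metric.totallyBounded_iff.2 fun ε hε => ?_
  obtain ⟨t, ht_sub, ht_fin, ht_cover⟩ := Metric.finite_approx_of_totallyBounded hS_tot ε hε
  obtain ⟨u, -, hu_fin, rfl⟩ := Set.exists_subset_image_finite_and.1 ⟨t, ht_sub, ht_fin, rfl⟩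
  refine ⟨T '' u, hu_fin.image T, ?_⟩
  rintro _ ⟨x, hx, rfl⟩
  obtain ⟨y, hy, hxy⟩ : ∃ y ∈ u, dist (S x) (S y) < ε := by
    simpa using ht_cover (Set.mem_image_of_mem S hx)
  rw [Set.biUnion_image, Set.mem_iUnion₂]
  refine ⟨y, hy, lt_of_le_of_lt ?_ hxy⟩
  simpa only [dist_eq_norm, map_sub] using hTS (x - y)

section PositiveOperator

variable {H : Type*} [NormedAddCommGroup H] [InnerProductSpace ℂ H]

theorem eigenspace_le_eigenspacesGE (a : H →L[ℂ] H) {t μ : ℝ} (hμ : t ≤ μ) :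
    eigenspace (a : H →ₗ[ℂ] H) (μ : ℂ) ≤ eigenspacesGE a t :=
  le_iSup₂_of_le μ hμ le_rfl

theorem le_norm_apply_of_mem_eigenspacesGE {a : H →L[ℂ] H} (ha : a.IsSymmetric) {t : ℝ}
    (ht : 0 ≤ t) {x : H} (hx : x ∈ eigenspacesGE a t) : t * ‖x‖ ≤ ‖a x‖ := by
  refine le_norm_apply_of_mem_iSup_eigenspace ha ht ?_
  refine (iSup₂_le fun μ hμ => ?_ : eigenspacesGE a t ≤ _) hx
  have hμ_norm : t ≤ ‖(μ : ℂ)‖ := by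
    rw [Complex.norm_real]
    exact hμ.trans (Real.le_norm_self μ)
  exact le_iSup (fun ν : {ν : ℂ // t ≤ ‖ν‖} => eigenspace (a : H →ₗ[ℂ] H) ν) ⟨μ, hμ_norm⟩

theorem apply_mem_eigenspacesGE {a : H →L[ℂ] H} {t : ℝ} {x : H} (hx : x ∈ eigenspacesGE a t) :
    a x ∈ eigenspacesGE a t := by
  refine (iSup₂_le fun μ hμ y hy => ?_ :
    eigenspacesGE a t ≤ (eigenspacesGE a t).comap (a : H →ₗ[ℂ] H)) hx
  rw [Submodule.mem_comap, mem_eigenspace_iff.1 hy]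
  exact Submodule.smul_mem _ _ (eigenspace_le_eigenspacesGE a hμ hy)

variable [CompleteSpace H]

theorem hasEigenvalue_norm_of_isPositive {a : H →L[ℂ] H} (ha : a.IsPositive)
    (hac : IsCompactOperator a) (ha_ne : a ≠ 0) : HasEigenvalue (a : End ℂ H) (‖a‖ : ℂ) := by
  have : Nontrivial (H →L[ℂ] H) := ⟨a, 0, ha_ne⟩
  rw [hac.hasEigenvalue_iff_mem_spectrum (by simpa using ha_ne)]
  exact spectrum.algebraMap_mem ℂ (CStarAlgebra.norm_mem_spectrum_of_nonneg
    ((ContinuousLinearMap.nonneg_iff_isPositive a).2 ha))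

theorem norm_apply_lt_of_mem_orthogonal_eigenspacesGE {a : H →L[ℂ] H} (ha : a.IsPositive)
    (hac : IsCompactOperator a) {t : ℝ} (ht : 0 < t) {x : H} (hx : x ∈ (eigenspacesGE a t)ᗮ)
    (hx_ne : x ≠ 0) : ‖a x‖ < t * ‖x‖ := by
  have hinv : ∀ y ∈ (eigenspacesGE a t)ᗮ, (a : H →ₗ[ℂ] H) y ∈ (eigenspacesGE a t)ᗮ :=
    ha.isSymmetric.orthogonalComplement_mem_invtSubmodule fun _ => apply_mem_eigenspacesGE
  let S := a.restrict hinv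
  have hS : S.IsPositive :=
    ⟨ha.isSymmetric.restrict_invariant hinv, fun y => ha.re_inner_nonneg_left y⟩
  have hS_norm : ‖S‖ < t := by
    by_contra! hle
    obtain ⟨v, hv⟩ := (hasEigenvalue_norm_of_isPositive hS (hac.restrict' hinv)
      (norm_pos_iff.1 (ht.trans_le hle))).exists_hasEigenvector
    have hv_mem : (v : H) ∈ eigenspacesGE a t :=
      eigenspace_le_eigenspacesGE a hle
        (mem_eigenspace_iff.2 (congrArg Subtype.val hv.apply_eq_smul))
    have hv_zero : (v : H) = 0 :=
      Submodule.disjoint_def.1 (Submodule.orthogonal_disjoint _) (v : H) hv_mem v.2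
    exact hv.2 (Subtype.ext hv_zero)
  calc ‖a x‖ = ‖S ⟨x, hx⟩‖ := rfl
    _ ≤ ‖S‖ * ‖x‖ := S.le_opNorm ⟨x, hx⟩
    _ < t * ‖x‖ := by gcongr

theorem isPositive_abs (a : H →L[ℂ] H) : (CFC.abs a).IsPositive :=
  (ContinuousLinearMap.nonneg_iff_isPositive _).1 (CFC.abs_nonneg a)

theorem norm_abs_apply (a : H →L[ℂ] H) (x : H) : ‖CFC.abs a x‖ = ‖a x‖ := by
  have hcomp : (CFC.abs a).adjoint ∘L CFC.abs a = a.adjoint ∘L a := by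
    rw [(isPositive_abs a).isSelfAdjoint.adjoint_eq]
    exact CFC.abs_mul_abs a
  rw [ContinuousLinearMap.apply_norm_eq_sqrt_inner_adjoint_left, hcomp,
    ← ContinuousLinearMap.apply_norm_eq_sqrt_inner_adjoint_left]

theorem isCompactOperator_abs {a : H →L[ℂ] H} (ha : IsCompactOperator a) :
    IsCompactOperator (CFC.abs a : H →L[ℂ] H) :=
  isCompactOperator_of_norm_apply_le (S := a.toLinearMap) (T := (CFC.abs a).toLinearMap) ha
    fun x => (norm_abs_apply a x).le

end PositiveOperator

section EigenvalueCount

variable {H : Type*} [NormedAddCommGroup H] [InnerProductSpace ℂ H]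

/-- The number of eigenvalues `μ ≥ t` of `a`, counted with multiplicity. Infinite dimensions are
all sent to `⊤`, as only comparisons with natural numbers matter for the eigenvalue sequence. -/
noncomputable def eigenvalueCountGE (a : H →L[ℂ] H) (t : ℝ) : ℕ∞ :=
  (Module.rank ℂ (eigenspacesGE a t)).toENat

theorem lt_eigenvalueSeq_iff {a : H →L[ℂ] H} {n : ℕ} {s : ℝ} (hs : 0 ≤ s) :
    s < eigenvalueSeq a n ↔ ∃ t, s < t ∧ (n + 1 : ℕ) ≤ eigenvalueCountGE a t := by
  simp only [eigenvalueCountGE, Cardinal.natCast_le_toENat]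
  constructor
  · intro h
    by_contra! hcon
    exact h.not_ge (Real.sSup_le (fun t ht => le_of_not_gt fun hst => (hcon t hst).not_ge ht.2) hs)
  · rintro ⟨t, hst, hn⟩
    exact hst.trans_le (le_csSup ⟨‖a‖, eigenvalueSeq_le_of_mem a n⟩ ⟨hs.trans_lt hst, hn⟩)

theorem eigenvalueCountGE_abs_add_le [CompleteSpace H] {b c : H →L[ℂ] H}
    (hb : IsCompactOperator b) (hc : IsCompactOperator c) {s t : ℝ} (hs : 0 < s) (ht : 0 < t) :
    eigenvalueCountGE (CFC.abs (b + c)) (s + t) ≤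
      eigenvalueCountGE (CFC.abs b) s + eigenvalueCountGE (CFC.abs c) t := by
  set V := eigenspacesGE (CFC.abs b) s
  set W := eigenspacesGE (CFC.abs c) t
  have hdisj : Disjoint (eigenspacesGE (CFC.abs (b + c)) (s + t)) (V ⊔ W)ᗮ := by
    rw [← Submodule.inf_orthogonal, Submodule.disjoint_def]
    rintro x hx ⟨hxb, hxc⟩
    by_contra hx_ne
    have hlower := le_norm_apply_of_mem_eigenspacesGE (isPositive_abs (b + c)).isSymmetric
      (add_pos hs ht).le hx
    have hupper_b := norm_apply_lt_of_mem_orthogonal_eigenspacesGE (isPositive_abs b)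
      (isCompactOperator_abs hb) hs hxb hx_ne
    have hupper_c := norm_apply_lt_of_mem_orthogonal_eigenspacesGE (isPositive_abs c)
      (isCompactOperator_abs hc) ht hxc hx_ne
    rw [norm_abs_apply] at hlower hupper_b hupper_c
    have htriangle : ‖(b + c) x‖ ≤ ‖b x‖ + ‖c x‖ := norm_add_le _ _
    linarith
  calc eigenvalueCountGE (CFC.abs (b + c)) (s + t)
      ≤ (Module.rank ℂ ↥(V ⊔ W)).toENat := toENat_rank_le_of_disjoint_orthogonal hdisj
    _ ≤ (Module.rank ℂ V + Module.rank ℂ W).toENat :=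
      Cardinal.toENat.monotone' (Submodule.rank_add_le_rank_add_rank V W)
    _ = eigenvalueCountGE (CFC.abs b) s + eigenvalueCountGE (CFC.abs c) t := map_add _ _ _

end EigenvalueCount

section Sugeno

variable {H : Type*} [NormedAddCommGroup H] [InnerProductSpace ℂ H] {α : ℕ → ℝ}

theorem sugenoTrace_nonneg (hα : ∀ n, 0 ≤ α n) (a : H →L[ℂ] H) : 0 ≤ sugenoTrace α a :=
  Real.iSup_nonneg fun _ => le_min (Real.sSup_nonneg fun _ ht => ht.1.le) (hα _)

theorem sugenoTrace_le_iff (hα_zero : α 0 = 0) {a : H →L[ℂ] H} {σ : ℝ} (hσ : 0 ≤ σ) :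
    sugenoTrace α a ≤ σ ↔ ∀ (n : ℕ) (t : ℝ), σ < t → n ≤ eigenvalueCountGE a t → α n ≤ σ := by
  calc sugenoTrace α a ≤ σ
    _ ↔ ∀ n, min (eigenvalueSeq a n) (α (n + 1)) ≤ σ := ciSup_le_iff (bddAbove_sugenoTrace α a)
    _ ↔ ∀ n, σ < eigenvalueSeq a n → α (n + 1) ≤ σ := by
      simp only [min_le_iff, or_iff_not_imp_left, not_le]
    _ ↔ ∀ n t, σ < t → (n + 1 : ℕ) ≤ eigenvalueCountGE a t → α (n + 1) ≤ σ := by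
      simp only [lt_eigenvalueSeq_iff hσ, forall_exists_index, and_imp]
    _ ↔ ∀ (n : ℕ) (t : ℝ), σ < t → n ≤ eigenvalueCountGE a t → α n ≤ σ :=
      ⟨fun h n => n.casesOn (fun _ _ _ => hα_zero.trans_le hσ) h, fun h n => h (n + 1)⟩

theorem mainTheorem8_general [CompleteSpace H] (hα_nonneg : ∀ n, 0 ≤ α n) (hα_zero : α 0 = 0)
    (hα_subadd : Subadditive α) {b c : H →L[ℂ] H} (hb : IsCompactOperator b)
    (hc : IsCompactOperator c) : sugenoNorm α (b + c) ≤ sugenoNorm α b + sugenoNorm α c := by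
  have hb_nonneg : 0 ≤ sugenoNorm α b := sugenoTrace_nonneg hα_nonneg _
  have hc_nonneg : 0 ≤ sugenoNorm α c := sugenoTrace_nonneg hα_nonneg _
  refine (sugenoTrace_le_iff hα_zero (add_nonneg hb_nonneg hc_nonneg)).2 fun n r hr hn => ?_
  obtain ⟨s, t, hs, ht, rfl⟩ : ∃ s t, sugenoNorm α b < s ∧ sugenoNorm α c < t ∧ s + t = r := by
    refine ⟨(sugenoNorm α b + (r - sugenoNorm α c)) / 2,
      (sugenoNorm α c + (r - sugenoNorm α b)) / 2, ?_, ?_, ?_⟩ <;> linarith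
  obtain ⟨p, q, rfl, hp, hq⟩ := exists_add_eq_of_natCast_le_add (hn.trans
    (eigenvalueCountGE_abs_add_le hb hc (hb_nonneg.trans_lt hs) (hc_nonneg.trans_lt ht)))
  calc α (p + q) ≤ α p + α q := hα_subadd p q
    _ ≤ sugenoNorm α b + sugenoNorm α c := add_le_add
      ((sugenoTrace_le_iff hα_zero hb_nonneg).1 le_rfl p s hs hp)
      ((sugenoTrace_le_iff hα_zero hc_nonneg).1 le_rfl q t ht hq)

end Sugeno

theorem mainTheorem8 {H : Type*} [NormedAddCommGroup H] [InnerProductSpace ℂ H] [CompleteSpace H]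
    [TopologicalSpace.SeparableSpace H] (hH : ¬ FiniteDimensional ℂ H)
    (α : ℕ → ℝ) (hα_mono : Monotone α) (hα_zero : α 0 = 0) (hα_one : 0 < α 1)
    (hα_concave : ∀ i : ℕ, 1 ≤ i → (α (i + 1) + α (i - 1)) / 2 ≤ α i)
    (b c : H →L[ℂ] H) (hb : IsCompactOperator b) (hc : IsCompactOperator c) :
    sugenoNorm α (b + c) ≤ sugenoNorm α b + sugenoNorm α c :=
  mainTheorem8_general (fun n => hα_zero ▸ hα_mono n.zero_le) hα_zero
    (subadditive_of_antitone_sub hα_zero.ge (antitone_sub_of_midpoint_le hα_concave)) hb hc
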